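/- **Proposition (Hyland).** Write $\{e\}$ for the $e$-th partial recursive function and $\langle -,-\rangle$ for a recursive pairing of natural numbers. Let $\mathbf{Asm}$ be the category of assemblies. Its objects are pairs $(P,T)$ with $P$ a set and $T\subseteq P\times\mathbb N$ such that every $x\in P$ satisfies $x\mathrel T n$ for some $n$. An arrow $(P,T)\to(P',T')$ is a function $f:P\to P'$ for which there is $t\in\mathbb N$ such that $x\mathrel T n$ implies that $\{t\}(n)$ is defined and $f(x)\mathrel{T'}\{t\}(n)$. Let $\mathbf{Eff}$ be the effective topos. For $\varphi,\psi:I\to\mathcal P(\mathbb N)$ write $\varphi\vdash_I\psi$ if there is one $e\in\mathbb N$ such that, for all $i\in I$ and $n\in\varphi(i)$, $\{e\}(n)$ is defined and lies in $\psi(i)$; connectives are read by realizability: $A\wedge B=\{\langle a,b\rangle\mid a\in A,\ b\in B\}$, $A\Rightarrow B=\{e\mid \{e\}(a)\text{ is defined and in }B\text{ for all }a\in A\}$, $\neg A=(A\Rightarrow\emptyset)$, and $\exists$ is union. Objects of $\mathbf{Eff}$ are sets $X$ with a map $[-=-]:X\times X\to\mathcal P(\mathbb N)$ such that $[x=y]\vdash[y=x]$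 and $[x=y]\wedge[y=z]\vdash[x=z]$. Arrows $X\to Y$ are strict, extensional, single-valued and total relations $F:X\times Y\to\mathcal P(\mathbb N)$, up to mutual entailment, composed by $(G\circ F)(x,z)=\bigcup_y F(x,y)\wedge G(y,z)$. An object $X$ of $\mathbf{Eff}$ is *$\neg\neg$-separated* if it is separated for the double negation topology: any two arrows $f,g:A\to X$ that agree on a $\neg\neg$-dense subobject $S$ of $A$ are equal. Here $S$ is $\neg\neg$-dense if $\neg\neg S$ is the largest subobject of $A$, i.e. every subobject of $A$ disjoint from $S$ is the least one. Let $I:\mathbf{Asm}\to\mathbf{Eff}$ be the functor sending $(P,T)$ to $P$ with $[x=y]=\{n\mid x=y\text{ and }x\mathrel T n\}$ and an arrow $f$ to the class of its graph $(x,y)\mapsto\{n\mid f(x)=y\text{ and }x\mathrel T n\}$. Then $I$ exhibits $\mathbf{Asm}$ as the full reflective subcategory of $\mathbf{Eff}$ on the $\neg\neg$-separated objects, that is: 1. $I$ is full and faithful and has a left adjoint; 2. an object of $\mathbf{Eff}$ is isomorphic to $I(P,T)$ for some assembly $(P,T)$ if and only if it is $\neg\neg$-separated; 3. an object $X$ of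 $\mathbf{Eff}$ is $\neg\neg$-separated if and only if its equality predicate is $\neg\neg$-closed, i.e. $[x=x]\wedge[y=y]\wedge\neg\neg[x=y]\ \vdash_{X\times X}\ [x=y]$. -/

import Mathlib

open CategoryTheory

universe u

/-! ### Kleene's first model and realizability predicates -/

/-- Kleene application `{e}(n)`: the `e`-th partial recursive function applied to `n`. -/
def kApp (e n : ℕ) : Part ℕ :=
  (Denumerable.ofNat Nat.Partrec.Code e).eval n

/-- Realizability conjunction: the set of (codes of) pairs of realizers. -/
def rAnd (A B : Set ℕ) : Set ℕ :=
  {n | n.unpair.1 ∈ A ∧ n.unpair.2 ∈ B}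

/-- Realizability implication: the set of indices of partial recursive functions that are defined
on all of `A` and send `A` into `B`. -/
def rImp (A B : Set ℕ) : Set ℕ :=
  {e | ∀ a ∈ A, ∃ b ∈ kApp e a, b ∈ B}

/-- Realizability negation: implication into falsity, which has no realizers. -/
def rNot (A : Set ℕ) : Set ℕ :=
  rImp A ∅

/-- Realizability existential quantification: union. -/
def rEx {J : Type*} (φ : J → Set ℕ) : Set ℕ :=
  {n | ∃ j, n ∈ φ j}

/-- Entailment of `𝒫(ℕ)`-valued predicates over a set `I`: some single number `e` realizes the
implication `φ i ⇒ ψ i` simultaneously for all `i : I`. -/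
def REnt {I : Type*} (φ ψ : I → Set ℕ) : Prop :=
  ∃ e : ℕ, ∀ i, e ∈ rImp (φ i) (ψ i)

namespace REnt

variable {I J : Type*} {φ ψ χ : I → Set ℕ}

theorem of_code (c : Nat.Partrec.Code)
    (h : ∀ i, ∀ a ∈ φ i, ∃ b ∈ c.eval a, b ∈ ψ i) : REnt φ ψ := by
  refine ⟨Encodable.encode c, fun i a ha => ?_⟩
  unfold kApp
  rw [Denumerable.ofNat_encode]
  exact h i a ha

theorem to_code (h : REnt φ ψ) :
    ∃ c : Nat.Partrec.Code, ∀ i, ∀ a ∈ φ i, ∃ b ∈ c.eval a, b ∈ ψ i := by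
  obtain ⟨e, he⟩ := h
  exact ⟨Denumerable.ofNat Nat.Partrec.Code e, he⟩

theorem of_le (h : ∀ i, φ i ⊆ ψ i) : REnt φ ψ :=
  of_code Nat.Partrec.Code.id fun i a ha =>
    ⟨a, by simp [Nat.Partrec.Code.eval_id], h i ha⟩

theorem refl (φ : I → Set ℕ) : REnt φ φ := of_le fun _ => subset_rfl

theorem trans (h₁ : REnt φ ψ) (h₂ : REnt ψ χ) : REnt φ χ := by
  obtain ⟨c, hc⟩ := h₁.to_code
  obtain ⟨d, hd⟩ := h₂.to_code
  refine of_code (d.comp c) fun i a ha => ?_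
  obtain ⟨b, hb, hb'⟩ := hc i a ha
  obtain ⟨k, hk, hk'⟩ := hd i b hb'
  refine ⟨k, ?_, hk'⟩
  exact Part.mem_bind_iff.2 ⟨b, hb, hk⟩

theorem and (h₁ : REnt φ ψ) (h₂ : REnt φ χ) : REnt φ fun i => rAnd (ψ i) (χ i) := by
  obtain ⟨c, hc⟩ := h₁.to_code
  obtain ⟨d, hd⟩ := h₂.to_code
  refine of_code (c.pair d) fun i a ha => ?_
  obtain ⟨b, hb, hb'⟩ := hc i a ha
  obtain ⟨k, hk, hk'⟩ := hd i a ha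
  refine ⟨Nat.pair b k, ?_, ?_⟩
  · simp only [Nat.Partrec.Code.eval, Seq.seq, Part.map_eq_map, Part.mem_bind_iff, Part.mem_map_iff]
    exact ⟨_, ⟨b, hb, rfl⟩, k, hk, rfl⟩
  · refine ⟨?_, ?_⟩ <;> rw [Nat.unpair_pair]
    exacts [hb', hk']

theorem left (φ ψ : I → Set ℕ) : REnt (fun i => rAnd (φ i) (ψ i)) φ :=
  of_code Nat.Partrec.Code.left fun i a ha => ⟨a.unpair.1, by simp [Nat.Partrec.Code.eval], ha.1⟩

theorem right (φ ψ : I → Set ℕ) : REnt (fun i => rAnd (φ i) (ψ i)) ψ :=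
  of_code Nat.Partrec.Code.right fun i a ha => ⟨a.unpair.2, by simp [Nat.Partrec.Code.eval], ha.2⟩

theorem reindex (h : REnt φ ψ) (f : J → I) : REnt (fun j => φ (f j)) fun j => ψ (f j) := by
  obtain ⟨e, he⟩ := h
  exact ⟨e, fun j => he (f j)⟩

theorem ex_elim {θ : I → J → Set ℕ} (h : REnt (fun p : I × J => θ p.1 p.2) fun p => ψ p.1) :
    REnt (fun i => rEx (θ i)) ψ := by
  obtain ⟨e, he⟩ := h
  exact ⟨e, fun i a ⟨j, hj⟩ => he (i, j) a hj⟩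

theorem ex_mono {θ η : I → J → Set ℕ}
    (h : REnt (fun p : I × J => θ p.1 p.2) fun p => η p.1 p.2) :
    REnt (fun i => rEx (θ i)) fun i => rEx (η i) := by
  obtain ⟨e, he⟩ := h
  refine ⟨e, fun i a ⟨j, hj⟩ => ?_⟩
  obtain ⟨b, hb, hb'⟩ := he (i, j) a hj
  exact ⟨b, hb, j, hb'⟩

theorem ex_intro {θ : I → J → Set ℕ} (f : I → J) (h : REnt φ fun i => θ i (f i)) :
    REnt φ fun i => rEx (θ i) :=
  h.trans (of_le fun i _ ha => ⟨f i, ha⟩)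

/-- Cut against an existential statement, keeping the context. -/
theorem ex_cut {θ : I → J → Set ℕ} (h : REnt φ fun i => rEx (θ i))
    (k : REnt (fun p : I × J => rAnd (φ p.1) (θ p.1 p.2)) fun p => ψ p.1) : REnt φ ψ := by
  refine ((refl φ).and h).trans (trans (of_le ?_)
    (ex_elim (θ := fun i j => rAnd (φ i) (θ i j)) k))
  rintro i a ⟨h₁, j, h₂⟩
  exact ⟨j, h₁, h₂⟩

end REnt

/-! ### The category of assemblies -/

/-- An assembly: a set with a total relation to `ℕ`. -/
structure Asm : Type (u + 1) where
  carrier : Type u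
  rel : carrier → ℕ → Prop
  total : ∀ x, ∃ n, rel x n

namespace Asm

/-- `t` tracks the function `f`. -/
def Tracks (P Q : Asm.{u}) (t : ℕ) (f : P.carrier → Q.carrier) : Prop :=
  ∀ x n, P.rel x n → ∃ m ∈ kApp t n, Q.rel (f x) m

/-- Arrows of assemblies: functions that are tracked by some number. -/
structure Hom (P Q : Asm.{u}) : Type u where
  toFun : P.carrier → Q.carrier
  tracked : ∃ t, Tracks P Q t toFun

/-- The realizers of an element of an assembly. -/
def realizers (P : Asm.{u}) (x : P.carrier) : Set ℕ :=
  {n | P.rel x n}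

theorem tracked_iff (P Q : Asm.{u}) (f : P.carrier → Q.carrier) :
    (∃ t, Tracks P Q t f) ↔ REnt P.realizers fun x => Q.realizers (f x) :=
  Iff.rfl

instance : Category.{u} Asm.{u} where
  Hom := Hom
  id P := ⟨fun x => x, REnt.refl P.realizers⟩
  comp f g := ⟨fun x => g.toFun (f.toFun x),
    ((tracked_iff _ _ _).1 f.tracked).trans
      (((tracked_iff _ _ _).1 g.tracked).reindex f.toFun)⟩

end Asm

/-! ### The effective topos -/

/-- An object of the effective topos: a set with a `𝒫(ℕ)`-valued (partial) equality predicate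
which is symmetric and transitive in the sense of realizability. -/
structure Eff : Type (u + 1) where
  carrier : Type u
  eq : carrier → carrier → Set ℕ
  symm : REnt (fun p : carrier × carrier => eq p.1 p.2) fun p => eq p.2 p.1
  trans : REnt (fun p : carrier × carrier × carrier => rAnd (eq p.1 p.2.1) (eq p.2.1 p.2.2))
    fun p => eq p.1 p.2.2

namespace Eff

/-- Functional relations: strict, extensional, single-valued and total `𝒫(ℕ)`-valued relations. -/
structure FunRel (X Y : Eff.{u}) : Type u where
  rel : X.carrier → Y.carrier → Set ℕ
  strict : REnt (fun p : X.carrier × Y.carrier => rel p.1 p.2)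
    fun p => rAnd (X.eq p.1 p.1) (Y.eq p.2 p.2)
  ext : REnt
    (fun p : (X.carrier × X.carrier) × (Y.carrier × Y.carrier) =>
      rAnd (rel p.1.1 p.2.1) (rAnd (X.eq p.1.1 p.1.2) (Y.eq p.2.1 p.2.2)))
    fun p => rel p.1.2 p.2.2
  single : REnt
    (fun p : X.carrier × Y.carrier × Y.carrier => rAnd (rel p.1 p.2.1) (rel p.1 p.2.2))
    fun p => Y.eq p.2.1 p.2.2
  total : REnt (fun x : X.carrier => X.eq x x) fun x => rEx fun y => rel x y

variable {X Y Z W : Eff.{u}}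

/-- Two functional relations are identified when they entail each other. -/
instance funRelSetoid (X Y : Eff.{u}) : Setoid (FunRel X Y) where
  r F G :=
    REnt (fun p : X.carrier × Y.carrier => F.rel p.1 p.2) (fun p => G.rel p.1 p.2) ∧
    REnt (fun p : X.carrier × Y.carrier => G.rel p.1 p.2) (fun p => F.rel p.1 p.2)
  iseqv :=
    { refl := fun _ => ⟨REnt.refl _, REnt.refl _⟩
      symm := fun h => ⟨h.2, h.1⟩
      trans := fun h k => ⟨h.1.trans k.1, k.2.trans h.2⟩ }

theorem ent_symm {I : Type*} {φ : I → Set ℕ} {a b : I → X.carrier}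
    (h : REnt φ fun i => X.eq (a i) (b i)) : REnt φ fun i => X.eq (b i) (a i) :=
  h.trans (X.symm.reindex fun i => (a i, b i))

theorem ent_trans {I : Type*} {φ : I → Set ℕ} {a b c : I → X.carrier}
    (h : REnt φ fun i => X.eq (a i) (b i)) (k : REnt φ fun i => X.eq (b i) (c i)) :
    REnt φ fun i => X.eq (a i) (c i) :=
  (h.and k).trans (X.trans.reindex fun i => (a i, b i, c i))

namespace FunRel

variable {I : Type*} {φ : I → Set ℕ}

theorem ent_dom (F : FunRel X Y) {x : I → X.carrier} {y : I → Y.carrier}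
    (h : REnt φ fun i => F.rel (x i) (y i)) : REnt φ fun i => X.eq (x i) (x i) :=
  (h.trans (F.strict.reindex fun i => (x i, y i))).trans (REnt.left _ _)

theorem ent_cod (F : FunRel X Y) {x : I → X.carrier} {y : I → Y.carrier}
    (h : REnt φ fun i => F.rel (x i) (y i)) : REnt φ fun i => Y.eq (y i) (y i) :=
  (h.trans (F.strict.reindex fun i => (x i, y i))).trans (REnt.right _ _)

theorem ent_ext (F : FunRel X Y) {x x' : I → X.carrier} {y y' : I → Y.carrier}
    (h : REnt φ fun i => F.rel (x i) (y i)) (hx : REnt φ fun i => X.eq (x i) (x' i))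
    (hy : REnt φ fun i => Y.eq (y i) (y' i)) : REnt φ fun i => F.rel (x' i) (y' i) :=
  (h.and (hx.and hy)).trans (F.ext.reindex fun i => ((x i, x' i), (y i, y' i)))

theorem ent_single (F : FunRel X Y) {x : I → X.carrier} {y y' : I → Y.carrier}
    (h : REnt φ fun i => F.rel (x i) (y i)) (k : REnt φ fun i => F.rel (x i) (y' i)) :
    REnt φ fun i => Y.eq (y i) (y' i) :=
  (h.and k).trans (F.single.reindex fun i => (x i, y i, y' i))

theorem ent_total (F : FunRel X Y) {x : I → X.carrier}
    (h : REnt φ fun i => X.eq (x i) (x i)) : REnt φ fun i => rEx fun y => F.rel (x i) y :=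
  h.trans (F.total.reindex x)

/-- The identity functional relation is the equality predicate. -/
def id (X : Eff.{u}) : FunRel X X where
  rel := X.eq
  strict :=
    have h := REnt.refl fun p : X.carrier × X.carrier => X.eq p.1 p.2
    (ent_trans h (ent_symm h)).and (ent_trans (ent_symm h) h)
  ext :=
    have h := REnt.left _ _
    have k := REnt.right _ _
    ent_trans (ent_symm (k.trans (REnt.left _ _))) (ent_trans h (k.trans (REnt.right _ _)))
  single := ent_trans (ent_symm (REnt.left _ _)) (REnt.right _ _)
  total := REnt.ex_intro (fun x => x) (REnt.refl _)

/-- Relational composition. -/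
def comp (F : FunRel X Y) (G : FunRel Y Z) : FunRel X Z where
  rel x z := rEx fun y => rAnd (F.rel x y) (G.rel y z)
  strict := REnt.ex_elim ((F.ent_dom (REnt.left _ _)).and (G.ent_cod (REnt.right _ _)))
  ext := by
    refine REnt.ex_cut (REnt.left _ _) (REnt.ex_intro (fun p => p.2) ?_)
    have c := REnt.left
      (fun p : ((X.carrier × X.carrier) × (Z.carrier × Z.carrier)) × Y.carrier =>
        rAnd (rEx fun y => rAnd (F.rel p.1.1.1 y) (G.rel y p.1.2.1))
          (rAnd (X.eq p.1.1.1 p.1.1.2) (Z.eq p.1.2.1 p.1.2.2)))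
      (fun p => rAnd (F.rel p.1.1.1 p.2) (G.rel p.2 p.1.2.1))
    have d := REnt.right
      (fun p : ((X.carrier × X.carrier) × (Z.carrier × Z.carrier)) × Y.carrier =>
        rAnd (rEx fun y => rAnd (F.rel p.1.1.1 y) (G.rel y p.1.2.1))
          (rAnd (X.eq p.1.1.1 p.1.1.2) (Z.eq p.1.2.1 p.1.2.2)))
      (fun p => rAnd (F.rel p.1.1.1 p.2) (G.rel p.2 p.1.2.1))
    have hF := d.trans (REnt.left _ _)
    have hG := d.trans (REnt.right _ _)
    have hX := (c.trans (REnt.right _ _)).trans (REnt.left _ _)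
    have hZ := (c.trans (REnt.right _ _)).trans (REnt.right _ _)
    exact (F.ent_ext hF hX (F.ent_cod hF)).and (G.ent_ext hG (G.ent_dom hG) hZ)
  single := by
    refine REnt.ex_cut (REnt.left _ _) ?_
    refine REnt.ex_cut ((REnt.left _ _).trans (REnt.right _ _)) ?_
    have d := REnt.right
      (fun p : ((X.carrier × Z.carrier × Z.carrier) × Y.carrier) × Y.carrier =>
        rAnd (rAnd (rEx fun y => rAnd (F.rel p.1.1.1 y) (G.rel y p.1.1.2.1))
            (rEx fun y => rAnd (F.rel p.1.1.1 y) (G.rel y p.1.1.2.2)))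
          (rAnd (F.rel p.1.1.1 p.1.2) (G.rel p.1.2 p.1.1.2.1)))
      (fun p => rAnd (F.rel p.1.1.1 p.2) (G.rel p.2 p.1.1.2.2))
    have c := (REnt.left
      (fun p : ((X.carrier × Z.carrier × Z.carrier) × Y.carrier) × Y.carrier =>
        rAnd (rAnd (rEx fun y => rAnd (F.rel p.1.1.1 y) (G.rel y p.1.1.2.1))
            (rEx fun y => rAnd (F.rel p.1.1.1 y) (G.rel y p.1.1.2.2)))
          (rAnd (F.rel p.1.1.1 p.1.2) (G.rel p.1.2 p.1.1.2.1)))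
      (fun p => rAnd (F.rel p.1.1.1 p.2) (G.rel p.2 p.1.1.2.2))).trans (REnt.right _ _)
    have hG := c.trans (REnt.right _ _)
    have hG' := d.trans (REnt.right _ _)
    have hY := F.ent_single (c.trans (REnt.left _ _)) (d.trans (REnt.left _ _))
    exact G.ent_single (G.ent_ext hG hY (G.ent_cod hG)) hG'
  total := by
    refine REnt.ex_cut F.total ?_
    have d := REnt.right
      (fun p : X.carrier × Y.carrier => X.eq p.1 p.1) (fun p => F.rel p.1 p.2)
    refine REnt.ex_cut (G.ent_total (F.ent_cod d)) ?_
    exact REnt.ex_intro (fun p => p.2) (REnt.ex_intro (fun p => p.1.2)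
      (((REnt.left _ _).trans (REnt.right _ _)).and (REnt.right _ _)))

theorem comp_ent {F F' : FunRel X Y} {G G' : FunRel Y Z}
    (h : REnt (fun p : X.carrier × Y.carrier => F.rel p.1 p.2) fun p => F'.rel p.1 p.2)
    (k : REnt (fun p : Y.carrier × Z.carrier => G.rel p.1 p.2) fun p => G'.rel p.1 p.2) :
    REnt (fun p : X.carrier × Z.carrier => (F.comp G).rel p.1 p.2)
      fun p => (F'.comp G').rel p.1 p.2 :=
  REnt.ex_mono (((REnt.left _ _).trans (h.reindex fun p : (X.carrier × Z.carrier) × Y.carrier =>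
      (p.1.1, p.2))).and
    ((REnt.right _ _).trans (k.reindex fun p : (X.carrier × Z.carrier) × Y.carrier =>
      (p.2, p.1.2))))

theorem comp_congr {F F' : FunRel X Y} {G G' : FunRel Y Z} (h : F ≈ F') (k : G ≈ G') :
    F.comp G ≈ F'.comp G' :=
  ⟨comp_ent h.1 k.1, comp_ent h.2 k.2⟩

theorem id_comp (F : FunRel X Y) : (id X).comp F ≈ F := by
  constructor
  · refine REnt.ex_elim ?_
    have h := REnt.left (fun p : (X.carrier × Y.carrier) × X.carrier => X.eq p.1.1 p.2)
      (fun p => F.rel p.2 p.1.2)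
    have k := REnt.right (fun p : (X.carrier × Y.carrier) × X.carrier => X.eq p.1.1 p.2)
      (fun p => F.rel p.2 p.1.2)
    exact F.ent_ext k (ent_symm h) (F.ent_cod k)
  · have h := REnt.refl fun p : X.carrier × Y.carrier => F.rel p.1 p.2
    exact REnt.ex_intro (fun p => p.1) ((F.ent_dom h).and h)

theorem comp_id (F : FunRel X Y) : F.comp (id Y) ≈ F := by
  constructor
  · refine REnt.ex_elim ?_
    have h := REnt.left (fun p : (X.carrier × Y.carrier) × Y.carrier => F.rel p.1.1 p.2)
      (fun p => Y.eq p.2 p.1.2)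
    have k := REnt.right (fun p : (X.carrier × Y.carrier) × Y.carrier => F.rel p.1.1 p.2)
      (fun p => Y.eq p.2 p.1.2)
    exact F.ent_ext h (F.ent_dom h) k
  · have h := REnt.refl fun p : X.carrier × Y.carrier => F.rel p.1 p.2
    exact REnt.ex_intro (fun p => p.2) (h.and (F.ent_cod h))

theorem assoc (F : FunRel X Y) (G : FunRel Y Z) (H : FunRel Z W) :
    (F.comp G).comp H ≈ F.comp (G.comp H) := by
  constructor
  · refine REnt.ex_elim (REnt.ex_cut (REnt.left _ _) ?_)
    refine REnt.ex_intro (fun p => p.2) (((REnt.right _ _).trans (REnt.left _ _)).and ?_)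
    exact REnt.ex_intro (fun p => p.1.2) (((REnt.right _ _).trans (REnt.right _ _)).and
      ((REnt.left _ _).trans (REnt.right _ _)))
  · refine REnt.ex_elim (REnt.ex_cut (REnt.right _ _) ?_)
    refine REnt.ex_intro (fun p => p.2) (REnt.and ?_ ((REnt.right _ _).trans (REnt.right _ _)))
    exact REnt.ex_intro (fun p => p.1.2) (((REnt.left _ _).trans (REnt.left _ _)).and
      ((REnt.right _ _).trans (REnt.left _ _)))

end FunRel

/-- The effective topos: arrows are functional relations up to mutual entailment. -/
instance : Category.{u} Eff.{u} where
  Hom X Y := Quotient (funRelSetoid X Y)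
  id X := Quotient.mk _ (FunRel.id X)
  comp f g := Quotient.map₂ FunRel.comp (fun _ _ h _ _ k => FunRel.comp_congr h k) f g
  id_comp f := Quotient.inductionOn f fun F => Quotient.sound F.id_comp
  comp_id f := Quotient.inductionOn f fun F => Quotient.sound F.comp_id
  assoc f g h := Quotient.inductionOn₃ f g h fun F G H => Quotient.sound (F.assoc G H)

/-- The equality predicate of `X` is `¬¬`-closed, as a predicate on `X × X`: uniformly in
`x, y`, from realizers of the existence of `x`, of the existence of `y`, and of `¬¬ (x = y)`,
one computes a realizer of `x = y`. -/
def EqIsDoubleNegClosed (X : Eff.{u}) : Prop :=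
  REnt (fun p : X.carrier × X.carrier =>
      rAnd (rAnd (X.eq p.1 p.1) (X.eq p.2 p.2)) (rNot (rNot (X.eq p.1 p.2))))
    fun p => X.eq p.1 p.2

end Eff

/-! ### Assemblies as objects of the effective topos -/

namespace Asm

/-- The assembly `(P, T)` as an object of the effective topos: `x = y` is realized by `n` when
`x` and `y` are the same element and `n` is one of its realizers. -/
def toEffObj (P : Asm.{u}) : Eff.{u} where
  carrier := P.carrier
  eq x y := {n | x = y ∧ P.rel x n}
  symm := REnt.of_le fun p n ⟨h, hn⟩ => ⟨h.symm, h ▸ hn⟩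
  trans := (REnt.left _ _).and (REnt.right _ _) |>.trans <| by
    refine REnt.trans (ψ := fun p : P.carrier × P.carrier × P.carrier =>
      {n | (p.1 = p.2.1 ∧ p.2.1 = p.2.2) ∧ P.rel p.1 n}) ?_
      (REnt.of_le fun p n ⟨h, hn⟩ => ⟨h.1.trans h.2, hn⟩)
    refine REnt.of_code Nat.Partrec.Code.left fun p n hn => ?_
    exact ⟨n.unpair.1, by simp [Nat.Partrec.Code.eval], ⟨hn.1.1, hn.2.1⟩, hn.1.2⟩

/-- The graph of an arrow of assemblies, as a functional relation. -/
def graph {P Q : Asm.{u}} (f : P ⟶ Q) : Eff.FunRel P.toEffObj Q.toEffObj where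
  rel x y := {n | f.toFun x = y ∧ P.rel x n}
  strict := by
    refine REnt.and (REnt.of_le fun p n h => ⟨rfl, h.2⟩) ?_
    obtain ⟨t, ht⟩ := f.tracked
    refine ⟨t, fun p n h => ?_⟩
    obtain ⟨m, hm, hm'⟩ := ht p.1 n h.2
    exact ⟨m, hm, rfl, h.1 ▸ hm'⟩
  ext := by
    refine REnt.of_code Nat.Partrec.Code.left fun p n hn => ?_
    obtain ⟨⟨h₁, h₂⟩, ⟨h₃, -⟩, h₄, -⟩ := hn
    exact ⟨n.unpair.1, by simp [Nat.Partrec.Code.eval],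
      (congrArg f.toFun h₃).symm.trans (h₁.trans h₄), h₃ ▸ h₂⟩
  single := by
    obtain ⟨t, ht⟩ := f.tracked
    refine REnt.trans (REnt.left _ _ |>.and (REnt.right _ _)) ?_
    refine REnt.trans (ψ := fun p : P.carrier × Q.carrier × Q.carrier =>
      {n | (f.toFun p.1 = p.2.1 ∧ f.toFun p.1 = p.2.2) ∧ P.rel p.1 n}) ?_ ?_
    · refine REnt.of_code Nat.Partrec.Code.left fun p n hn => ?_
      exact ⟨n.unpair.1, by simp [Nat.Partrec.Code.eval], ⟨hn.1.1, hn.2.1⟩, hn.1.2⟩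
    · refine ⟨t, fun p n h => ?_⟩
      obtain ⟨m, hm, hm'⟩ := ht p.1 n h.2
      exact ⟨m, hm, h.1.1.symm.trans h.1.2, h.1.1 ▸ hm'⟩
  total := REnt.ex_intro (fun x => f.toFun x) (REnt.of_le fun x n h => ⟨rfl, h.2⟩)

/-- The inclusion of assemblies into the effective topos. -/
def toEff : Asm.{u} ⥤ Eff.{u} where
  obj := toEffObj
  map f := Quotient.mk _ (graph f)
  map_id P := Quotient.sound ⟨REnt.refl _, REnt.refl _⟩
  map_comp {P Q R} f g := by
    refine Quotient.sound ⟨?_, ?_⟩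
    · refine REnt.ex_intro (fun p => f.toFun p.1) (REnt.and ?_ ?_)
      · exact REnt.of_le fun p n h => ⟨rfl, h.2⟩
      · obtain ⟨t, ht⟩ := f.tracked
        refine ⟨t, fun p n h => ?_⟩
        obtain ⟨m, hm, hm'⟩ := ht p.1 n h.2
        exact ⟨m, hm, h.1, hm'⟩
    · refine REnt.ex_elim (REnt.of_code Nat.Partrec.Code.left fun p n hn => ?_)
      obtain ⟨⟨h₁, h₂⟩, h₃, -⟩ := hn
      exact ⟨n.unpair.1, by simp [Nat.Partrec.Code.eval],
        (congrArg g.toFun h₁).trans h₃, h₂⟩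

end Asm

/-! ### Double-negation separated objects -/

/-- Two subobjects are disjoint: every subobject below both is the least subobject. -/
def SubobjectDisjoint {C : Type*} [Category C] {A : C} (S T : Subobject A) : Prop :=
  ∀ V : Subobject A, V ≤ S → V ≤ T → IsBot V

/-- A subobject `S` is `¬¬`-dense: its pseudocomplement is least, that is, every subobject disjoint
from `S` is the least subobject. (In a topos, this is density for the double negation topology,
`¬¬S = ⊤`.) -/
def IsDoubleNegDense {C : Type*} [Category C] {A : C} (S : Subobject A) : Prop :=
  ∀ U : Subobject A, SubobjectDisjoint U S → IsBot U

/-- `X` is `¬¬`-separated: two arrows into `X` which agree on a `¬¬`-dense subobject are equal. -/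
def DoubleNegSeparated (C : Type*) [Category C] : ObjectProperty C := fun X =>
  ∀ (A : C) (S : Subobject A), IsDoubleNegDense S →
    ∀ f g : A ⟶ X, S.arrow ≫ f = S.arrow ≫ g → f = g

/-! ### Inhabitedness of realizability predicates -/

/-! A double negation keeps only whether a predicate is inhabited: `rNot (rNot A)` is everything
when `A` is inhabited and empty otherwise. So `¬¬`-closed equality means that, once `x = y` has some
realizer, one can be computed uniformly from realizers of existence of `x` and `y`. Arrows into such
an object are determined by the pairs they relate (`EqIsDoubleNegClosed.hom_ext`).

Testing with global elements, a subobject is `¬¬`-dense exactly when it meets every existing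
element. Hence closed equality gives separation. Conversely, the diagonal is dense in the object of
pairs whose equality is inhabited. The two projections agree on it, so separation makes them equal
into `X`, and a realizer of that equality of arrows is the uniform algorithm wanted.

The reflection divides the existing elements by inhabited equality, and a class inherits the
realizers of all its members. In an assembly inhabited equality is actual equality, so arrows into
it factor uniquely through this quotient. When equality is closed, the converse of the unit is
single-valued, and the unit is invertible. -/

theorem rAnd_nonempty {A B : Set ℕ} : (rAnd A B).Nonempty ↔ A.Nonempty ∧ B.Nonempty := by
  constructor
  · rintro ⟨n, h, k⟩
    exact ⟨⟨_, h⟩, _, k⟩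
  · rintro ⟨⟨a, ha⟩, b, hb⟩
    exact ⟨Nat.pair a b, by simpa [rAnd] using ⟨ha, hb⟩⟩

theorem rEx_nonempty {J : Type*} {φ : J → Set ℕ} :
    (rEx φ).Nonempty ↔ ∃ j, (φ j).Nonempty :=
  ⟨fun ⟨n, j, h⟩ => ⟨j, n, h⟩, fun ⟨j, n, h⟩ => ⟨n, j, h⟩⟩

/-- `rNot A` is then empty, so the implication out of it holds vacuously for every index. -/
theorem mem_rNot_rNot {A : Set ℕ} (h : A.Nonempty) (n : ℕ) : n ∈ rNot (rNot A) := by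
  intro e he
  obtain ⟨a, ha⟩ := h
  obtain ⟨b, -, hb⟩ := he a ha
  exact hb.elim

theorem nonempty_of_mem_rNot_rNot {A : Set ℕ} {n : ℕ} (h : n ∈ rNot (rNot A)) : A.Nonempty := by
  by_contra hA
  -- For empty `A` any number lies in `rNot A`; 0 is an arbitrary choice.
  obtain ⟨b, -, hb⟩ := h 0 fun a ha => (hA ⟨a, ha⟩).elim
  exact hb

namespace REnt

variable {I : Type*} {φ ψ : I → Set ℕ}

theorem nonempty (h : REnt φ ψ) {i : I} (hi : (φ i).Nonempty) : (ψ i).Nonempty := by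
  obtain ⟨e, he⟩ := h
  obtain ⟨a, ha⟩ := hi
  obtain ⟨b, -, hb⟩ := he i a ha
  exact ⟨b, hb⟩

theorem of_const (n : ℕ) (h : ∀ i, (φ i).Nonempty → n ∈ ψ i) : REnt φ ψ :=
  of_code (Nat.Partrec.Code.const n) fun i a ha =>
    ⟨n, by simp [Nat.Partrec.Code.eval_const], h i ⟨a, ha⟩⟩

theorem of_isEmpty (h : ∀ i, ¬ (φ i).Nonempty) : REnt φ ψ :=
  of_const 0 fun i hi => (h i hi).elim

/-- Lets facts without computational content, valid as soon as the premise is inhabited, alter the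
conclusion while the code stays the same. -/
theorem mono_of_nonempty {χ : I → Set ℕ} (h : REnt φ ψ)
    (k : ∀ i, (φ i).Nonempty → ψ i ⊆ χ i) : REnt φ χ := by
  obtain ⟨e, he⟩ := h
  refine ⟨e, fun i a ha => ?_⟩
  obtain ⟨b, hb, hb'⟩ := he i a ha
  exact ⟨b, hb, k i ⟨a, ha⟩ hb'⟩

end REnt

/-! ### Arrows through the pairs they relate -/

namespace Eff

variable {X Y Z : Eff.{u}}

theorem eq_nonempty_symm {x y : X.carrier} (h : (X.eq x y).Nonempty) : (X.eq y x).Nonempty :=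
  X.symm.nonempty (i := (x, y)) h

theorem eq_nonempty_trans {x y z : X.carrier} (h : (X.eq x y).Nonempty)
    (k : (X.eq y z).Nonempty) : (X.eq x z).Nonempty :=
  X.trans.nonempty (i := (x, y, z)) (rAnd_nonempty.2 ⟨h, k⟩)

/-- The arrow `f` relates `x` to `y`: the predicate representing it is inhabited there. -/
def Relates (f : X ⟶ Y) (x : X.carrier) (y : Y.carrier) : Prop :=
  Quotient.lift (fun F : FunRel X Y => (F.rel x y).Nonempty)
    (fun F G (h : F ≈ G) => propext ⟨h.1.nonempty (i := (x, y)), h.2.nonempty (i := (x, y))⟩) f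

theorem relates_comp (f : X ⟶ Y) (g : Y ⟶ Z) (x : X.carrier) (z : Z.carrier) :
    Relates (f ≫ g) x z ↔ ∃ y, Relates f x y ∧ Relates g y z := by
  induction f using Quotient.inductionOn with | _ F
  induction g using Quotient.inductionOn with | _ G
  exact rEx_nonempty.trans (exists_congr fun y => rAnd_nonempty)

namespace Relates

variable {f : X ⟶ Y} {x x' : X.carrier} {y y' : Y.carrier}

theorem dom (h : Relates f x y) : (X.eq x x).Nonempty := by
  induction f using Quotient.inductionOn with | _ F
  exact (rAnd_nonempty.1 (F.strict.nonempty (i := (x, y)) h)).1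

theorem cod (h : Relates f x y) : (Y.eq y y).Nonempty := by
  induction f using Quotient.inductionOn with | _ F
  exact (rAnd_nonempty.1 (F.strict.nonempty (i := (x, y)) h)).2

theorem congr (h : Relates f x y) (hx : (X.eq x x').Nonempty) (hy : (Y.eq y y').Nonempty) :
    Relates f x' y' := by
  induction f using Quotient.inductionOn with | _ F
  exact F.ext.nonempty (i := ((x, x'), (y, y')))
    (rAnd_nonempty.2 ⟨h, rAnd_nonempty.2 ⟨hx, hy⟩⟩)

theorem single (h : Relates f x y) (k : Relates f x y') : (Y.eq y y').Nonempty := by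
  induction f using Quotient.inductionOn with | _ F
  exact F.single.nonempty (i := (x, y, y')) (rAnd_nonempty.2 ⟨h, k⟩)

end Relates

theorem exists_relates (f : X ⟶ Y) {x : X.carrier} (h : (X.eq x x).Nonempty) :
    ∃ y, Relates f x y := by
  induction f using Quotient.inductionOn with | _ F
  exact rEx_nonempty.1 (F.total.nonempty (i := x) h)

/-- It suffices to check one entailment in order to identify two functional relations. -/
theorem FunRel.equiv_of_ent {F G : FunRel X Y}
    (h : REnt (fun p : X.carrier × Y.carrier => F.rel p.1 p.2) fun p => G.rel p.1 p.2) :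
    F ≈ G := by
  refine ⟨h, ?_⟩
  have hG := REnt.refl fun p : X.carrier × Y.carrier => G.rel p.1 p.2
  refine REnt.ex_cut (F.ent_total (G.ent_dom hG)) ?_
  have k := REnt.right (fun p : (X.carrier × Y.carrier) × Y.carrier => G.rel p.1.1 p.1.2)
    (fun p => F.rel p.1.1 p.2)
  exact F.ent_ext k (F.ent_dom k)
    (G.ent_single (k.trans (h.reindex fun p : (X.carrier × Y.carrier) × Y.carrier =>
      (p.1.1, p.2))) (REnt.left _ _))

/-- The number 0 realizes the double negation of anything inhabited, so only the two existence
realizers have to be computed. -/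
theorem EqIsDoubleNegClosed.ent_eq (hX : X.EqIsDoubleNegClosed) {I : Type*} {φ : I → Set ℕ}
    {x y : I → X.carrier} (h : REnt φ fun i => X.eq (x i) (x i))
    (k : REnt φ fun i => X.eq (y i) (y i))
    (hxy : ∀ i, (φ i).Nonempty → (X.eq (x i) (y i)).Nonempty) :
    REnt φ fun i => X.eq (x i) (y i) :=
  ((h.and k).and (REnt.of_const 0 fun i hi => mem_rNot_rNot (hxy i hi) 0)).trans
    (REnt.reindex hX fun i => (x i, y i))

/-- Arrows into an object with `¬¬`-closed equality are determined by the pairs they relate. -/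
theorem EqIsDoubleNegClosed.hom_ext (hY : Y.EqIsDoubleNegClosed) {f g : X ⟶ Y}
    (h : ∀ x y, Relates f x y → ∃ y', Relates f x y' ∧ Relates g x y') : f = g := by
  induction f using Quotient.inductionOn with | _ F
  induction g using Quotient.inductionOn with | _ G
  refine Quotient.sound (FunRel.equiv_of_ent ?_)
  have hF := REnt.refl fun p : X.carrier × Y.carrier => F.rel p.1 p.2
  refine REnt.ex_cut (G.ent_total (F.ent_dom hF)) ?_
  have hl := REnt.left (fun p : (X.carrier × Y.carrier) × Y.carrier => F.rel p.1.1 p.1.2)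
    (fun p => G.rel p.1.1 p.2)
  have hr := REnt.right (fun p : (X.carrier × Y.carrier) × Y.carrier => F.rel p.1.1 p.1.2)
    (fun p => G.rel p.1.1 p.2)
  -- Totality of `G` supplies some value; closed equality turns its merely inhabited equality with
  -- the value of `F` into a computed one.
  refine G.ent_ext hr (G.ent_dom hr) (hY.ent_eq (G.ent_cod hr) (F.ent_cod hl) fun p hp => ?_)
  obtain ⟨hp₁, hp₂⟩ := rAnd_nonempty.1 hp
  obtain ⟨y', h₁, h₂⟩ := h p.1.1 p.1.2 hp₁
  exact eq_nonempty_trans (Relates.single (f := Quotient.mk _ G) hp₂ h₂)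
    (Relates.single (f := Quotient.mk _ F) h₁ hp₁)

/-! ### Degenerate objects and global elements -/

/-- The initial object. -/
def empty : Eff.{u} where
  carrier := PEmpty
  eq x _ := x.elim
  symm := REnt.of_isEmpty fun p => p.1.elim
  trans := REnt.of_isEmpty fun p => p.1.elim

/-- The unique arrow out of an object without existing elements. -/
def fromDegenerate (h : ∀ x, ¬ (X.eq x x).Nonempty) (Y : Eff.{u}) : X ⟶ Y :=
  Quotient.mk _
    { rel := fun _ _ => ∅
      strict := REnt.of_isEmpty fun _ => Set.not_nonempty_empty
      ext := REnt.of_isEmpty fun _ hp => Set.not_nonempty_empty (rAnd_nonempty.1 hp).1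
      single := REnt.of_isEmpty fun _ hp => Set.not_nonempty_empty (rAnd_nonempty.1 hp).1
      total := REnt.of_isEmpty h }

theorem hom_eq_of_degenerate (h : ∀ x, ¬ (X.eq x x).Nonempty) (f g : X ⟶ Y) : f = g := by
  induction f using Quotient.inductionOn with | _ F
  induction g using Quotient.inductionOn with | _ G
  exact Quotient.sound (FunRel.equiv_of_ent (REnt.of_isEmpty fun p hp =>
    h p.1 (Relates.dom (f := Quotient.mk _ F) hp)))

/-- A least subobject maps to the empty one, and an arrow sends existing elements to existing
elements. Without existing elements, any two parallel arrows out agree. -/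
theorem isBot_iff_degenerate {A : Eff.{u}} (V : Subobject A) :
    IsBot V ↔ ∀ v, ¬ ((V : Eff.{u}).eq v v).Nonempty := by
  constructor
  · intro h v hv
    have hm : Mono (fromDegenerate (X := empty) (fun x => x.elim) A) :=
      ⟨fun g _ _ => hom_eq_of_degenerate
        (fun x hx => (exists_relates g hx).elim fun y _ => PEmpty.elim y) _ _⟩
    obtain ⟨y, -⟩ := exists_relates (Subobject.ofLEMk V _ (h (Subobject.mk
      (fromDegenerate (X := empty) (fun x => x.elim) A)))) hv
    exact y.elim
  · intro h W
    exact Subobject.le_of_comm (fromDegenerate h _) (hom_eq_of_degenerate h _ _)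

/-- The terminal object. -/
def one : Eff.{u} where
  carrier := PUnit
  eq _ _ := Set.univ
  symm := REnt.of_const 0 fun _ _ => Set.mem_univ _
  trans := REnt.of_const 0 fun _ _ => Set.mem_univ _

theorem one_eqIsDoubleNegClosed : one.{u}.EqIsDoubleNegClosed :=
  REnt.of_const 0 fun _ _ => Set.mem_univ _

theorem hom_one_eq (f g : X ⟶ one) : f = g :=
  one_eqIsDoubleNegClosed.hom_ext fun x y h => by
    obtain ⟨y', hy'⟩ := exists_relates g h.dom
    exact ⟨y, h, hy'⟩

/-- The global element given by an existing element. -/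
def point (x : X.carrier) (h : (X.eq x x).Nonempty) : one ⟶ X :=
  Quotient.mk _
    { rel := fun _ y => X.eq x y
      strict := by
        have k := REnt.refl fun p : one.carrier × X.carrier => X.eq x p.2
        exact REnt.and (REnt.of_const 0 fun _ _ => Set.mem_univ _) (ent_trans (ent_symm k) k)
      ext := ent_trans (REnt.left _ _) ((REnt.right _ _).trans (REnt.right _ _))
      single := ent_trans (ent_symm (REnt.left _ _)) (REnt.right _ _)
      total := REnt.ex_intro (fun _ => x) (REnt.of_const h.some fun _ _ => h.some_mem) }

theorem relates_point {x y : X.carrier} (h : (X.eq x x).Nonempty) (k : (X.eq x y).Nonempty)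
    (t : one.{u}.carrier) : Relates (point x h) t y :=
  k

/-- No closure of equality is needed: the domain has a single element, so one realizer on each side,
used as a constant, is already uniform. -/
theorem hom_from_one_ext {f g : one ⟶ X} {t : one.{u}.carrier} {x : X.carrier}
    (hf : Relates f t x) (hg : Relates g t x) : f = g := by
  induction f using Quotient.inductionOn with | _ F
  induction g using Quotient.inductionOn with | _ G
  obtain ⟨m, hm⟩ := hf
  obtain ⟨n, hn⟩ := hg
  refine Quotient.sound (FunRel.equiv_of_ent ?_)
  have hF := REnt.refl fun p : one.carrier × X.carrier => F.rel p.1 p.2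
  have hm' : REnt (fun p : one.carrier × X.carrier => F.rel p.1 p.2) fun p => F.rel p.1 x :=
    REnt.of_const m fun _ _ => hm
  have hn' : REnt (fun p : one.carrier × X.carrier => F.rel p.1 p.2) fun p => G.rel p.1 x :=
    REnt.of_const n fun _ _ => hn
  exact G.ent_ext hn' (G.ent_dom hn') (F.ent_single hm' hF)

instance mono_from_one (f : one ⟶ X) : Mono f :=
  ⟨fun _ _ _ => hom_one_eq _ _⟩

/-- A `¬¬`-dense subobject meets every existing element. -/
theorem exists_relates_of_dense {A : Eff.{u}} {S : Subobject A} (hS : IsDoubleNegDense S)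
    {a : A.carrier} (ha : (A.eq a a).Nonempty) : ∃ s, Relates S.arrow s a := by
  by_contra hne
  -- If nothing in `S` lies over `a`, the global element at `a` is disjoint from `S`, hence least by
  -- density, although it has an existing element.
  have hbot : IsBot (Subobject.mk (point a ha)) := by
    refine hS _ fun V hV hVS => (isBot_iff_degenerate V).2 fun v hv => hne ?_
    obtain ⟨b, hb⟩ := exists_relates V.arrow hv
    have h₁ := hb
    rw [← Subobject.ofLEMk_comp hV, relates_comp] at h₁
    rw [← Subobject.ofLE_arrow hVS, relates_comp] at hb
    obtain ⟨t, -, ht⟩ := h₁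
    obtain ⟨s, -, hs⟩ := hb
    have hab : (A.eq a b).Nonempty := ht
    exact ⟨s, hs.congr hs.dom (eq_nonempty_symm hab)⟩
  obtain ⟨v, hv⟩ := exists_relates (Subobject.underlyingIso (point a ha)).inv
    (x := PUnit.unit) Set.univ_nonempty
  exact (isBot_iff_degenerate _).1 hbot v hv.cod

/-- An existing element of `U` and an element of `S` over the same `a` induce the same global
element of `A`. It lies below both subobjects and is not least. -/
theorem isDoubleNegDense_of_exists_relates {A : Eff.{u}} {S : Subobject A}
    (hS : ∀ a, (A.eq a a).Nonempty → ∃ s, Relates S.arrow s a) : IsDoubleNegDense S := by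
  refine fun U hU => (isBot_iff_degenerate U).2 fun u hu => ?_
  obtain ⟨a, ha⟩ := exists_relates U.arrow hu
  obtain ⟨s, hs⟩ := hS a ha.cod
  have hcomm : point s hs.dom ≫ S.arrow = point u hu ≫ U.arrow :=
    hom_from_one_ext (t := PUnit.unit) (x := a)
      ((relates_comp _ _ _ _).2 ⟨s, relates_point _ hs.dom _, hs⟩)
      ((relates_comp _ _ _ _).2 ⟨u, relates_point _ hu _, ha⟩)
  have hbot := hU (Subobject.mk (point u hu ≫ U.arrow))
    (Subobject.mk_le_of_comm _ rfl) (Subobject.mk_le_of_comm _ hcomm)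
  obtain ⟨v, hv⟩ := exists_relates (Subobject.underlyingIso (point u hu ≫ U.arrow)).inv
    (x := PUnit.unit) Set.univ_nonempty
  exact (isBot_iff_degenerate _).1 hbot v hv.cod

/-! ### Separated objects are those with `¬¬`-closed equality -/

/-- Density puts some `s` over each `a` where `f` has a value; that value is shared by both
composites at `s`, and single-valuedness of the inclusion brings it back to `a`. -/
theorem EqIsDoubleNegClosed.doubleNegSeparated (hX : X.EqIsDoubleNegClosed) :
    DoubleNegSeparated Eff.{u} X := by
  intro A S hS f g hfg
  refine hX.hom_ext fun a x hx => ?_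
  obtain ⟨s, hs⟩ := exists_relates_of_dense hS hx.dom
  have h : Relates (S.arrow ≫ g) s x := by
    rw [← hfg]
    exact (relates_comp _ _ _ _).2 ⟨a, hs, hx⟩
  obtain ⟨b, hb, hbx⟩ := (relates_comp _ _ _ _).1 h
  exact ⟨x, hx, hbx.congr (hb.single hs) hbx.cod⟩

/-- The pairs of elements of `X` which are `¬¬`-equal. -/
def weaklyEqualPairs (X : Eff.{u}) : Eff.{u} where
  carrier := {p : X.carrier × X.carrier // (X.eq p.1 p.2).Nonempty}
  eq p q := rAnd (X.eq p.1.1 q.1.1) (X.eq p.1.2 q.1.2)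
  symm := (ent_symm (REnt.left _ _)).and (ent_symm (REnt.right _ _))
  trans :=
    (ent_trans ((REnt.left _ _).trans (REnt.left _ _)) ((REnt.right _ _).trans (REnt.left _ _))).and
      (ent_trans ((REnt.left _ _).trans (REnt.right _ _))
        ((REnt.right _ _).trans (REnt.right _ _)))

theorem ent_cod_of_eq {I : Type*} {φ : I → Set ℕ} {a b : I → X.carrier}
    (h : REnt φ fun i => X.eq (a i) (b i)) : REnt φ fun i => X.eq (b i) (b i) :=
  ent_trans (ent_symm h) h

/-- A map of underlying sets which preserves equality uniformly induces a functional relation. -/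
def FunRel.ofMap (f : X.carrier → Y.carrier)
    (hf : REnt (fun p : X.carrier × X.carrier => X.eq p.1 p.2) fun p => Y.eq (f p.1) (f p.2)) :
    FunRel X Y where
  rel x y := rAnd (X.eq x x) (Y.eq (f x) y)
  strict := (REnt.left _ _).and (ent_cod_of_eq (REnt.right _ _))
  ext := by
    have h₁ := (REnt.right (fun p : (X.carrier × X.carrier) × (Y.carrier × Y.carrier) =>
        rAnd (X.eq p.1.1 p.1.1) (Y.eq (f p.1.1) p.2.1))
      (fun p => rAnd (X.eq p.1.1 p.1.2) (Y.eq p.2.1 p.2.2))).trans (REnt.left _ _)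
    refine (ent_cod_of_eq h₁).and ?_
    exact ent_trans (ent_symm (h₁.trans (hf.reindex fun p : (X.carrier × X.carrier) ×
      (Y.carrier × Y.carrier) => p.1))) (ent_trans ((REnt.left _ _).trans (REnt.right _ _))
        ((REnt.right _ _).trans (REnt.right _ _)))
  single := ent_trans (ent_symm ((REnt.left _ _).trans (REnt.right _ _)))
    ((REnt.right _ _).trans (REnt.right _ _))
  total := REnt.ex_intro f ((REnt.refl _).and (hf.reindex fun x => (x, x)))

/-- The arrow induced by a map of underlying sets which preserves equality uniformly. -/
def homOfMap (f : X.carrier → Y.carrier)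
    (hf : REnt (fun p : X.carrier × X.carrier => X.eq p.1 p.2) fun p => Y.eq (f p.1) (f p.2)) :
    X ⟶ Y :=
  Quotient.mk _ (FunRel.ofMap f hf)

theorem relates_homOfMap {f : X.carrier → Y.carrier}
    {hf : REnt (fun p : X.carrier × X.carrier => X.eq p.1 p.2) fun p => Y.eq (f p.1) (f p.2)}
    {x : X.carrier} {y : Y.carrier} :
    Relates (homOfMap f hf) x y ↔ (X.eq x x).Nonempty ∧ (Y.eq (f x) y).Nonempty :=
  rAnd_nonempty

theorem homOfMap_comp_eq_id {f : X.carrier → Y.carrier} {g : Y.carrier → X.carrier}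
    (hf : REnt (fun p : X.carrier × X.carrier => X.eq p.1 p.2) fun p => Y.eq (f p.1) (f p.2))
    (hg : REnt (fun p : Y.carrier × Y.carrier => Y.eq p.1 p.2) fun p => X.eq (g p.1) (g p.2))
    (h : ∀ x, g (f x) = x) : homOfMap f hf ≫ homOfMap g hg = 𝟙 X := by
  refine Quotient.sound (FunRel.equiv_of_ent (REnt.ex_elim ?_))
  have hl := (REnt.left (fun p : (X.carrier × X.carrier) × Y.carrier =>
      rAnd (X.eq p.1.1 p.1.1) (Y.eq (f p.1.1) p.2))
    (fun p => rAnd (Y.eq p.2 p.2) (X.eq (g p.2) p.1.2))).trans (REnt.right _ _)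
  have hl' := hl.trans (hg.reindex fun p : (X.carrier × X.carrier) × Y.carrier =>
    (f p.1.1, p.2))
  have hr := ent_trans hl' ((REnt.right _ _).trans (REnt.right _ _))
  simp only [h] at hr
  exact hr

/-- The object `X` with the elements which do not exist discarded. -/
def existing (X : Eff.{u}) : Eff.{u} where
  carrier := {x : X.carrier // (X.eq x x).Nonempty}
  eq x y := X.eq x.1 y.1
  symm := ent_symm (REnt.refl _)
  trans := ent_trans (REnt.left _ _) (REnt.right _ _)

/-- The diagonal, as an arrow into the object of `¬¬`-equal pairs. -/
def diagonal (X : Eff.{u}) : existing X ⟶ weaklyEqualPairs X :=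
  homOfMap (fun x => ⟨(x.1, x.1), x.2⟩) ((REnt.refl _).and (REnt.refl _))

/-- The first projection from the object of `¬¬`-equal pairs. -/
def projFst (X : Eff.{u}) : weaklyEqualPairs X ⟶ existing X :=
  homOfMap (fun p => ⟨p.1.1, eq_nonempty_trans p.2 (eq_nonempty_symm p.2)⟩) (REnt.left _ _)

/-- The second projection from the object of `¬¬`-equal pairs. -/
def projSnd (X : Eff.{u}) : weaklyEqualPairs X ⟶ existing X :=
  homOfMap (fun p => ⟨p.1.2, eq_nonempty_trans (eq_nonempty_symm p.2) p.2⟩) (REnt.right _ _)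

theorem diagonal_projFst (X : Eff.{u}) : diagonal X ≫ projFst X = 𝟙 _ :=
  homOfMap_comp_eq_id _ _ fun _ => rfl

theorem diagonal_projSnd (X : Eff.{u}) : diagonal X ≫ projSnd X = 𝟙 _ :=
  homOfMap_comp_eq_id _ _ fun _ => rfl

instance (X : Eff.{u}) : Mono (diagonal X) :=
  mono_of_mono_fac (diagonal_projFst X)

/-- A pair with inhabited equality is inhabitedly equal to the diagonal pair on its first component.
-/
theorem isDoubleNegDense_diagonal (X : Eff.{u}) : IsDoubleNegDense (Subobject.mk (diagonal X)) := by
  refine isDoubleNegDense_of_exists_relates fun a ha => ?_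
  have hx : (X.eq a.1.1 a.1.1).Nonempty := eq_nonempty_trans a.2 (eq_nonempty_symm a.2)
  have h : Relates (diagonal X) ⟨a.1.1, hx⟩ a :=
    relates_homOfMap.2 ⟨hx, rAnd_nonempty.2 ⟨hx, a.2⟩⟩
  rw [← Subobject.underlyingIso_arrow (diagonal X)] at h
  obtain ⟨s, -, hs⟩ := (relates_comp _ _ _ _).1 h
  exact ⟨s, hs⟩

/-- The inclusion of the existing elements. -/
def existingInclusion (X : Eff.{u}) : existing X ⟶ X :=
  homOfMap (fun x => x.1) (REnt.refl _)

/-- Equality of the two projections is itself an entailment, and its code is the algorithm required.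
-/
theorem eqIsDoubleNegClosed_of_doubleNegSeparated (hX : DoubleNegSeparated Eff.{u} X) :
    X.EqIsDoubleNegClosed := by
  have harrow : (Subobject.mk (diagonal X)).arrow ≫ projFst X =
      (Subobject.mk (diagonal X)).arrow ≫ projSnd X := by
    rw [← Subobject.underlyingIso_hom_comp_eq_mk, Category.assoc, Category.assoc,
      diagonal_projFst, diagonal_projSnd]
  have h := hX _ _ (isDoubleNegDense_diagonal X) (projFst X ≫ existingInclusion X)
    (projSnd X ≫ existingInclusion X) (by simp only [← Category.assoc, harrow])
  have hπ : REnt (fun a : (weaklyEqualPairs X).carrier =>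
      rAnd (X.eq a.1.1 a.1.1) (X.eq a.1.2 a.1.2)) fun a => X.eq a.1.1 a.1.2 := by
    -- Evaluated at the value `a.1.1`: the first projection relates `a` to it, hence so does the
    -- second, which says that the components are equal.
    refine REnt.trans ?_ (REnt.trans ((Quotient.exact h).1.reindex
      fun a : (weaklyEqualPairs X).carrier => (a, a.1.1)) (REnt.ex_elim ?_))
    · have hl := REnt.left (fun a : (weaklyEqualPairs X).carrier => X.eq a.1.1 a.1.1)
        (fun a => X.eq a.1.2 a.1.2)
      exact REnt.ex_intro
        (fun a => ⟨a.1.1, eq_nonempty_trans a.2 (eq_nonempty_symm a.2)⟩)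
        (((REnt.refl _).and hl).and (hl.and hl))
    · exact ent_symm (ent_trans ((REnt.left _ _).trans (REnt.right _ _))
        ((REnt.right _ _).trans (REnt.right _ _)))
  obtain ⟨e, he⟩ := hπ
  -- The double negation contributes only inhabitedness, which places `p` in the index set of `hπ`;
  -- the code `e` is then reused.
  refine REnt.trans (ψ := fun p : X.carrier × X.carrier =>
    {n | n ∈ rAnd (X.eq p.1 p.1) (X.eq p.2 p.2) ∧ (X.eq p.1 p.2).Nonempty})
    ((REnt.left _ _).mono_of_nonempty fun p hp n hn => ⟨hn, ?_⟩) ⟨e, fun p n hn => ?_⟩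
  · obtain ⟨m, hm⟩ := (rAnd_nonempty.1 hp).2
    exact nonempty_of_mem_rNot_rNot hm
  · exact he ⟨p, hn.2⟩ n hn.1

end Eff

/-! ### Assemblies as a reflective subcategory -/

namespace Asm

open Eff

variable {P Q : Asm.{u}} {X : Eff.{u}}

theorem Hom.ext' {f g : P ⟶ Q} (h : ∀ x, f.toFun x = g.toFun x) : f = g := by
  obtain ⟨f, hf⟩ := f
  obtain ⟨g, hg⟩ := g
  obtain rfl : f = g := funext h
  rfl

theorem toEffObj_eq_nonempty {x y : P.carrier} : (P.toEffObj.eq x y).Nonempty ↔ x = y :=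
  ⟨fun ⟨_, h, _⟩ => h, fun h => (P.total x).imp fun _ hn => ⟨h, hn⟩⟩

/-- Inhabited equality is actual equality here, so a realizer of `x` already realizes it. -/
theorem toEffObj_eqIsDoubleNegClosed (P : Asm.{u}) : P.toEffObj.EqIsDoubleNegClosed :=
  ((REnt.left _ _).trans (REnt.left _ _)).mono_of_nonempty fun _ hp _ hn =>
    have ⟨_, hm⟩ := (rAnd_nonempty.1 hp).2
    ⟨toEffObj_eq_nonempty.1 (nonempty_of_mem_rNot_rNot hm), hn.2⟩

theorem relates_toEff_map {f : P ⟶ Q} {x : P.carrier} {y : Q.carrier} :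
    Relates (toEff.map f) x y ↔ f.toFun x = y :=
  ⟨fun ⟨_, h, _⟩ => h, fun h => (P.total x).imp fun _ hn => ⟨h, hn⟩⟩

/-- A realizability-tracked family of values of an arrow into an assembly. -/
theorem ent_realizers_of_relates (F : FunRel X Q.toEffObj) {I : Type*} {φ : I → Set ℕ}
    {x : I → X.carrier} {y : I → Q.carrier} (hx : REnt φ fun i => X.eq (x i) (x i))
    (h : ∀ i, (F.rel (x i) (y i)).Nonempty) : REnt φ fun i => Q.realizers (y i) := by
  -- Totality computes a realizer of some value. Single-valuedness identifies that value with `y i`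
  -- on the nose, so the realizer is kept.
  refine REnt.ex_cut (F.ent_total hx) ((F.ent_cod (REnt.right _ _)).mono_of_nonempty ?_)
  intro p hp n hn
  have h₁ := toEffObj_eq_nonempty.1
    (Relates.single (f := Quotient.mk _ F) (h p.1) (rAnd_nonempty.1 hp).2)
  exact h₁.symm ▸ hn.2

instance : toEff.{u}.Faithful where
  map_injective {P Q f g} h := Hom.ext' fun x => by
    have hf := relates_toEff_map.2 (Eq.refl (f.toFun x))
    rw [h] at hf
    exact (relates_toEff_map.1 hf).symm

/-- The values are chosen classically; totality of the functional relation provides the tracker. -/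
instance : toEff.{u}.Full where
  map_surjective {P Q} f := by
    choose y hy using fun x : P.carrier =>
      exists_relates f (toEffObj_eq_nonempty.2 (Eq.refl x))
    refine ⟨⟨y, ?_⟩, (toEffObj_eqIsDoubleNegClosed Q).hom_ext fun x z h => ?_⟩
    · induction f using Quotient.inductionOn with | _ F
      exact ent_realizers_of_relates F (x := fun x => x)
        (REnt.of_le fun x n hn => ⟨rfl, hn⟩) hy
    · obtain rfl := relates_toEff_map.1 h
      exact ⟨y x, h, hy x⟩

/-- Existing elements of `X` are identified when their equality has a realizer. -/
def existingSetoid (X : Eff.{u}) : Setoid {x : X.carrier // (X.eq x x).Nonempty} where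
  r x y := (X.eq x.1 y.1).Nonempty
  iseqv := ⟨fun x => x.2, eq_nonempty_symm, eq_nonempty_trans⟩

/-- The reflection of an object of the effective topos into assemblies. -/
def reflection (X : Eff.{u}) : Asm.{u} where
  carrier := Quotient (existingSetoid X)
  rel c n := ∃ x, Quotient.mk _ x = c ∧ n ∈ X.eq x.1 x.1
  total c := Quotient.inductionOn c fun x => x.2.imp fun _ hn => ⟨x, rfl, hn⟩

/-- The unit of the reflection. -/
def toReflectionRel (X : Eff.{u}) : FunRel X (reflection X).toEffObj where
  rel x c := {n | n ∈ X.eq x x ∧ ∃ h, Quotient.mk (existingSetoid X) ⟨x, h⟩ = c}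
  strict := REnt.and (REnt.of_le fun _ _ h => h.1)
    (REnt.of_le fun _ _ ⟨h, hx, hc⟩ => ⟨rfl, ⟨_, hx⟩, hc, h⟩)
  ext := by
    refine (ent_cod_of_eq ((REnt.right _ _).trans (REnt.left _ _))).mono_of_nonempty ?_
    rintro ⟨⟨x, x'⟩, c, c'⟩ hp n hn
    obtain ⟨⟨_, _, hx, hxc⟩, hp'⟩ := rAnd_nonempty.1 hp
    obtain ⟨hxx', hc⟩ := rAnd_nonempty.1 hp'
    exact ⟨hn, ⟨n, hn⟩, (Quotient.sound (eq_nonempty_symm hxx')).trans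
      (hxc.trans (toEffObj_eq_nonempty.1 hc))⟩
  single := by
    refine (REnt.left _ _).mono_of_nonempty ?_
    rintro ⟨x, c, c'⟩ hp n ⟨hn, hx, hc⟩
    obtain ⟨-, _, _, hx', hc'⟩ := rAnd_nonempty.1 hp
    exact ⟨hc.symm.trans hc', ⟨x, hx⟩, hc, hn⟩
  total := REnt.of_le fun x n hn => ⟨Quotient.mk _ ⟨x, ⟨n, hn⟩⟩, hn, ⟨n, hn⟩, rfl⟩

/-- The unit of the reflection, as an arrow of the effective topos. -/
def toReflection (X : Eff.{u}) : X ⟶ toEff.obj (reflection X) :=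
  Quotient.mk _ (toReflectionRel X)

theorem relates_toReflection {x : X.carrier} {c : (reflection X).carrier} :
    Relates (toReflection X) x c ↔ ∃ h, Quotient.mk (existingSetoid X) ⟨x, h⟩ = c :=
  ⟨fun ⟨_, _, h⟩ => h, fun ⟨h, hc⟩ => h.imp fun _ hn => ⟨hn, h, hc⟩⟩

theorem relates_toReflection_comp {g : reflection X ⟶ P} {x : X.carrier}
    (h : (X.eq x x).Nonempty) {y : P.carrier} :
    Relates (toReflection X ≫ toEff.map g) x y ↔ g.toFun (Quotient.mk _ ⟨x, h⟩) = y := by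
  refine (relates_comp _ _ _ _).trans ⟨?_, ?_⟩
  · rintro ⟨c, hc, hy⟩
    obtain ⟨_, rfl⟩ := relates_toReflection.1 hc
    exact relates_toEff_map.1 hy
  · exact fun hy => ⟨_, relates_toReflection.2 ⟨h, rfl⟩, relates_toEff_map.2 hy⟩

/-- A factorization is forced on each class by the value at a representative. Inhabitedly equal
elements have equal values in an assembly, so the choice descends. -/
theorem toReflection_comp_bijective (X : Eff.{u}) (P : Asm.{u}) :
    Function.Bijective fun g : reflection X ⟶ P => toReflection X ≫ toEff.map g := by
  constructor
  · intro g g' hg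
    refine Hom.ext' fun c => Quotient.inductionOn c fun x => ?_
    have h := (relates_toReflection_comp (g := g) x.2).2 rfl
    rw [show toReflection X ≫ toEff.map g = toReflection X ≫ toEff.map g' from hg] at h
    exact ((relates_toReflection_comp x.2).1 h).symm
  · intro f
    choose y hy using fun x : {x : X.carrier // (X.eq x x).Nonempty} => exists_relates f x.2
    refine ⟨⟨Quotient.lift y fun a b hab => ?_, ?_⟩, ?_⟩
    · exact toEffObj_eq_nonempty.1 (((hy a).congr hab (hy a).cod).single (hy b))
    · induction f using Quotient.inductionOn with | _ F
      have h := ent_realizers_of_relates F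
        (φ := fun x : {x : X.carrier // (X.eq x x).Nonempty} => X.eq x.1 x.1)
        (REnt.refl _) hy
      obtain ⟨e, he⟩ := h
      refine ⟨e, ?_⟩
      rintro _ n ⟨x, rfl, hn⟩
      -- A realizer of a class realizes the existence of some member, so the code found for members
      -- tracks the descended map.
      exact he x n hn
    · refine (toEffObj_eqIsDoubleNegClosed P).hom_ext fun x z hz => ?_
      have hx := hz.dom
      exact ⟨y ⟨x, hx⟩, (relates_toReflection_comp hx).2 rfl, hy ⟨x, hx⟩⟩

/-- Arrows out of the reflection correspond to arrows of the effective topos. -/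
noncomputable def reflectionHomEquiv (X : Eff.{u}) (P : Asm.{u}) :
    (reflection X ⟶ P) ≃ (X ⟶ toEff.obj P) :=
  Equiv.ofBijective _ (toReflection_comp_bijective X P)

/-- Assemblies form a reflective subcategory of the effective topos. -/
theorem nonempty_reflective_toEff : Nonempty (Reflective toEff.{u}) :=
  ⟨{  L := Adjunction.leftAdjointOfEquiv reflectionHomEquiv fun X P Q g h => by
        simp [reflectionHomEquiv]
      adj := Adjunction.adjunctionOfEquivLeft _ _ }⟩

/-- If the equality of `X` is `¬¬`-closed, then the unit of the reflection has an inverse. -/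
def fromReflectionRel (hX : X.EqIsDoubleNegClosed) : FunRel (reflection X).toEffObj X where
  rel c x := (toReflectionRel X).rel x c
  strict := ((toReflectionRel X).strict.reindex Prod.swap).trans
    ((REnt.right _ _).and (REnt.left _ _))
  ext := (toReflectionRel X).ent_ext (REnt.left _ _) ((REnt.right _ _).trans (REnt.right _ _))
    ((REnt.right _ _).trans (REnt.left _ _))
  single := by
    -- Two members of one class are only inhabitedly equal; this is where closure of equality
    -- enters.
    refine hX.ent_eq ((toReflectionRel X).ent_dom (REnt.left _ _))
      ((toReflectionRel X).ent_dom (REnt.right _ _)) ?_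
    rintro ⟨c, x, x'⟩ hp
    obtain ⟨⟨_, _, _, h⟩, _, _, _, h'⟩ := rAnd_nonempty.1 hp
    exact Quotient.exact (h.trans h'.symm)
  total := REnt.of_le fun c n ⟨_, x, hx, hn⟩ => ⟨x.1, hn, x.2, hx⟩

/-- The inverse is the converse relation. Both objects have closed equality, so the composites need
only be compared on related pairs. -/
theorem isIso_toReflection (hX : X.EqIsDoubleNegClosed) : IsIso (toReflection X) := by
  let i : toEff.obj (reflection X) ⟶ X := Quotient.mk _ (fromReflectionRel hX)
  have hi : ∀ c x, Relates i c x ↔ Relates (toReflection X) x c := fun _ _ => Iff.rfl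
  refine ⟨i, hX.hom_ext fun x z h => ?_,
    (toEffObj_eqIsDoubleNegClosed _).hom_ext fun c d h => ?_⟩
  · obtain ⟨c, hc⟩ := exists_relates (toReflection X) h.dom
    exact ⟨x, (relates_comp _ _ _ _).2 ⟨c, hc, (hi _ _).2 hc⟩, h.dom⟩
  · obtain ⟨x, hx⟩ := exists_relates i h.dom
    exact ⟨c, (relates_comp _ _ _ _).2 ⟨x, hx, (hi _ _).1 hx⟩, h.dom⟩

end Asm

theorem DoubleNegSeparated.of_iso {C : Type*} [Category C] {X Y : C} (i : X ≅ Y)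
    (hX : DoubleNegSeparated C X) : DoubleNegSeparated C Y := by
  intro A S hS f g hfg
  rw [← cancel_mono i.inv]
  refine hX A S hS _ _ ?_
  rw [← Category.assoc, hfg, Category.assoc]

theorem proposition4p12 :
    Nonempty (Reflective Asm.toEff.{u}) ∧
      (∀ X : Eff.{u}, Asm.toEff.{u}.essImage X ↔ DoubleNegSeparated Eff.{u} X) ∧
      (∀ X : Eff.{u}, DoubleNegSeparated Eff.{u} X ↔ X.EqIsDoubleNegClosed) := by
  refine ⟨Asm.nonempty_reflective_toEff, fun X => ⟨?_, fun hX => ?_⟩, fun X =>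
    ⟨Eff.eqIsDoubleNegClosed_of_doubleNegSeparated,
      Eff.EqIsDoubleNegClosed.doubleNegSeparated⟩⟩
  -- Isomorphism invariance is immediate for separation, which is stated through arrows alone.
  · rintro ⟨P, ⟨i⟩⟩
    exact (Asm.toEffObj_eqIsDoubleNegClosed P).doubleNegSeparated.of_iso i
  · have := Asm.isIso_toReflection (Eff.eqIsDoubleNegClosed_of_doubleNegSeparated hX)
    exact ⟨_, ⟨(asIso (Asm.toReflection X)).symm⟩⟩
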